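/- Let $A=\{a,b,c\}$ be a three-letter alphabet, let $A^*$ be the free monoid on $A$ (words, with empty word $\varepsilon$), and let $\Gamma_A$ be the free group on $A$, with $A^*\subset\Gamma_A$. A substitution over $A$ is a monoid morphism $\sigma:A^*\to A^*$; it is identified with the triple $(\sigma(a),\sigma(b),\sigma(c))$ and with its natural extension to an endomorphism of $\Gamma_A$, and it is called invertible if this extension is an automorphism of $\Gamma_A$. A substitution is called simple if it belongs to the monoid generated under composition by the permutations of $A$ (regarded as substitutions) and the two substitutions $(ba,b,c)$ and $(ab,b,c)$. For $w\in\Gamma_A$ let $I_w$ denote the inner automorphism $u\mapsto wuw^{-1}$ of $\Gamma_A$. **Theorem.** Let $\sigma$ be an invertible substitution over $A$. Then there exists $w\in\Gamma_A$ with $w\in A^*$ or $w^{-1}\in A^*$ such that $I_w\circ\sigma$ is a simple substitution. Moreover, $w$ can be chosen so that either $w\in A^*$ and $w$ is a common suffix of $\sigma(a)$, $\sigma(b)$ and $\sigma(c)$, or $w^{-1}\in A^*$ and $w^{-1}$ is a common prefix of $\sigma(a)$, $\sigma(b)$ and $\sigma(c)$. (Prefixes and suffixes may be empty or the whole word.)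 -/

import Mathlib

/-- The three-letter alphabet `A = {a, b, c}`. -/
inductive Letter : Type
  | a
  | b
  | c
  deriving DecidableEq

/-- A substitution over `A`: a morphism of the free monoid `A*`. The multiplication of
`Monoid.End` is composition, `(σ * τ) u = σ (τ u)`. -/
abbrev Substitution : Type := Monoid.End (FreeMonoid Letter)

/-- The canonical embedding of `A*` in the free group `Γ_A`. -/
def wordToGroup : FreeMonoid Letter →* FreeGroup Letter :=
  FreeMonoid.lift FreeGroup.of

namespace Substitution

/-- The substitution `(u, v, w)`, that is, `a ↦ u`, `b ↦ v`, `c ↦ w`. -/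
def ofTriple (u v w : FreeMonoid Letter) : Substitution :=
  FreeMonoid.lift (fun x : Letter =>
    match x with
    | Letter.a => u
    | Letter.b => v
    | Letter.c => w)

/-- The natural extension of a substitution to an endomorphism of the free group `Γ_A`. -/
def extend (σ : Substitution) : FreeGroup Letter →* FreeGroup Letter :=
  FreeGroup.lift (fun x : Letter => wordToGroup (σ (FreeMonoid.of x)))

/-- A substitution is invertible if its extension to `Γ_A` is an automorphism. -/
def IsInvertible (σ : Substitution) : Prop :=
  Function.Bijective σ.extend

/-- The substitution that permutes the letters according to `π`. -/
def ofPerm (π : Equiv.Perm Letter) : Substitution :=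
  FreeMonoid.map π

/-- The substitution `(ba, b, c)`. -/
def phiL : Substitution :=
  ofTriple (FreeMonoid.of Letter.b * FreeMonoid.of Letter.a)
    (FreeMonoid.of Letter.b) (FreeMonoid.of Letter.c)

/-- The substitution `(ab, b, c)`. -/
def phiR : Substitution :=
  ofTriple (FreeMonoid.of Letter.a * FreeMonoid.of Letter.b)
    (FreeMonoid.of Letter.b) (FreeMonoid.of Letter.c)

/-- The monoid of simple substitutions: the submonoid (under composition) generated by the
permutations, `(ba, b, c)` and `(ab, b, c)`. -/
def simpleMonoid : Submonoid Substitution :=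
  Submonoid.closure (Set.range ofPerm ∪ {phiL, phiR})

end Substitution

/-- An endomorphism of `Γ_A` is a simple substitution if it is (the extension of) an element
of the monoid of simple substitutions. -/
def IsSimpleSubstitution (f : FreeGroup Letter →* FreeGroup Letter) : Prop :=
  ∃ τ : Substitution, τ ∈ Substitution.simpleMonoid ∧ f = τ.extend

/-- The inner automorphism `I_z : u ↦ z u z⁻¹` of `Γ_A`. -/
def innerAut (z : FreeGroup Letter) : FreeGroup Letter →* FreeGroup Letter :=
  (MulAut.conj z).toMonoidHom

/-- `u` is a common prefix of `σ(a)`, `σ(b)`, `σ(c)`. -/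
def IsCommonPrefix (u : FreeMonoid Letter) (σ : Substitution) : Prop :=
  ∀ x : Letter, ∃ v : FreeMonoid Letter, σ (FreeMonoid.of x) = u * v

/-- `u` is a common suffix of `σ(a)`, `σ(b)`, `σ(c)`. -/
def IsCommonSuffix (u : FreeMonoid Letter) (σ : Substitution) : Prop :=
  ∀ x : Letter, ∃ v : FreeMonoid Letter, σ (FreeMonoid.of x) = v * u

/-! ### Generating families with uncancelled cores -/

namespace FreeGroup

variable {α ι : Type*}

/-! Induct on |σ(a)| + |σ(b)| + |σ(c)|. If one image is a prefix or a suffix of another, an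
elementary simple substitution splits off on the right and leaves shorter images. In general, write
the images as c r(x) d, with c their longest common prefix and d the longest common suffix of what
remains. The triples r(x) d c and d c r(x) are conjugates of σ, so a prefix or suffix relation in
one of them serves as well. The conjugating word is then followed back through the rotation
(`of_rotate_left`, `of_rotate_right`).

If no relation is found, the images are conjugate to r(x) s with s = d c, where the r(x) have
neither a first nor a last letter in common and none is a prefix or suffix of another. It remains to
see that these words are letters, so that σ is a permutation. This is a Nielsen-type argument
(`norm_eq_one_of_core`). Let each generator contain a nonempty core that survives in every product
of two signed generators. Then a reduced product of n factors has length at least n, so every letter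
is a generator or the inverse of one, and counting leaves no other generators.

Positive words cancel only along common prefixes and suffixes. Among the r(x), one word differs from
the other two in its first letter and one in its last letter, so the nontrivial sharing involves one
pair for prefixes and one pair for suffixes, equal or distinct. If the shared parts leave a gap
inside each word, the gaps are cores. If they meet or overlap, Nielsen moves give a generating
triple that has cores but contains a word of length at least two, which is impossible. -/

theorem isReduced_invRev {L : List (α × Bool)} (h : IsReduced L) : IsReduced (invRev L) := by
  rw [isReduced_iff_not_step] at h ⊢
  intro L₂ h₂
  refine h (invRev L₂) ?_
  have := h₂.invRev
  rwa [invRev_invRev] at this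

/-- If the cores `M e` of the signed generators survive in every product of two consecutive
signed generators, then they survive in every reduced product. -/
theorem exists_prod_eq_of_core (X : ι × Bool → FreeGroup α) (A M : ι × Bool → List (α × Bool))
    (hM : ∀ e, M e ≠ [])
    (hX : ∀ e, ∃ R, IsReduced (M e ++ R) ∧ X e = mk (A e ++ M e ++ R))
    (hXX : ∀ e f : ι × Bool, (e.1 = f.1 → e.2 = f.2) →
      ∃ C, IsReduced (M e ++ C ++ M f) ∧ X e * mk (A f ++ M f) = mk (A e ++ M e ++ C ++ M f))
    (l : List (ι × Bool)) (e : ι × Bool) (hl : IsReduced (e :: l)) :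
    ∃ R, l.length ≤ R.length ∧ IsReduced (M e ++ R) ∧
      ((e :: l).map X).prod = mk (A e ++ M e ++ R) := by
  induction l generalizing e with
  | nil =>
    obtain ⟨R, hR, h⟩ := hX e
    exact ⟨R, by simp, hR, by simpa using h⟩
  | cons f l ih =>
    rw [isReduced_cons_cons] at hl
    obtain ⟨R, hlen, hR, h⟩ := ih f hl.2
    obtain ⟨C, hC, hef⟩ := hXX e f hl.1
    -- The nonempty core of `f` is the overlap along which the two reduced pieces are glued, and it
    -- contributes at least one letter.
    refine ⟨C ++ M f ++ R, ?_, ?_, ?_⟩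
    · have := List.length_pos_iff.mpr (hM f)
      simp only [List.length_append, List.length_cons]
      omega
    · have := hC.append_overlap hR (hM f)
      simpa [List.append_assoc] using this
    · rw [List.map_cons, List.prod_cons, h, ← mul_mk, ← mul_assoc, hef, mul_mk]
      simp [List.append_assoc]

theorem norm_mk_of_isReduced [DecidableEq α] {L : List (α × Bool)} (h : IsReduced L) :
    norm (mk L) = L.length := by
  rw [norm, toWord_mk, h.reduce_eq]

/-- A generating family whose members have uncancelled cores consists of letters and inverses of
letters, provided that it has as many members as there are letters. -/
theorem norm_eq_one_of_core [DecidableEq α] [Fintype α] [Fintype ι] [LinearOrder ι]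
    (hcard : Fintype.card ι = Fintype.card α)
    (A M B : ι → List (α × Bool))
    (hM : ∀ i, M i ≠ [])
    (hred : ∀ i, IsReduced (A i ++ M i ++ B i))
    (hpp : ∀ i j, ∃ C, mk C = mk (B i ++ A j) ∧ IsReduced (M i ++ C ++ M j))
    (hpn : ∀ i j, i < j → ∃ C, mk C = mk (B i ++ invRev (B j)) ∧
      IsReduced (M i ++ C ++ invRev (M j)))
    (hnp : ∀ i j, i < j → ∃ C, mk C = mk (invRev (A i) ++ A j) ∧
      IsReduced (invRev (M i) ++ C ++ M j))
    (hgen : Subgroup.closure (Set.range fun i => mk (A i ++ M i ++ B i)) = ⊤) (i : ι) :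
    (A i ++ M i ++ B i).length = 1 := by
  -- Inverting the product exchanges `i` and `j`, so the hypotheses for `i < j` suffice.
  have hpn' : ∀ i j, i ≠ j → ∃ C, mk C = mk (B i ++ invRev (B j)) ∧
      IsReduced (M i ++ C ++ invRev (M j)) := by
    intro i j hij
    rcases lt_or_gt_of_ne hij with h | h
    · exact hpn i j h
    · obtain ⟨C, h1, h2⟩ := hpn j i h
      refine ⟨invRev C, by rw [← inv_mk, h1, inv_mk]; simp [invRev_append], ?_⟩
      simpa [invRev_append, List.append_assoc] using isReduced_invRev h2
  have hnp' : ∀ i j, i ≠ j → ∃ C, mk C = mk (invRev (A i) ++ A j) ∧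
      IsReduced (invRev (M i) ++ C ++ M j) := by
    intro i j hij
    rcases lt_or_gt_of_ne hij with h | h
    · exact hnp i j h
    · obtain ⟨C, h1, h2⟩ := hnp j i h
      refine ⟨invRev C, by rw [← inv_mk, h1, inv_mk]; simp [invRev_append], ?_⟩
      simpa [invRev_append, List.append_assoc] using isReduced_invRev h2
  set x : ι → FreeGroup α := fun i => mk (A i ++ M i ++ B i) with hx
  let X : ι × Bool → FreeGroup α := fun e => cond e.2 (x e.1) (x e.1)⁻¹
  let A' : ι × Bool → List (α × Bool) := fun e => cond e.2 (A e.1) (invRev (B e.1))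
  let M' : ι × Bool → List (α × Bool) := fun e => cond e.2 (M e.1) (invRev (M e.1))
  let B' : ι × Bool → List (α × Bool) := fun e => cond e.2 (B e.1) (invRev (A e.1))
  have hX' : ∀ e, X e = mk (A' e ++ M' e ++ B' e) := by
    rintro ⟨i, _ | _⟩
    · simp [X, A', M', B', x, inv_mk, invRev_append]
    · simp [X, A', M', B', x]
  have hM' : ∀ e, M' e ≠ [] := by
    rintro ⟨i, _ | _⟩
    · intro h
      have h2 := congrArg invRev h
      simp only [M', cond_false, invRev_invRev, invRev_empty] at h2
      exact hM i h2
    · exact hM i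
  have hred' : ∀ e, IsReduced (A' e ++ M' e ++ B' e) := by
    rintro ⟨i, _ | _⟩
    · simpa [A', M', B', invRev_append] using isReduced_invRev (hred i)
    · exact hred i
  have hCC : ∀ e f : ι × Bool, (e.1 = f.1 → e.2 = f.2) →
      ∃ C, mk C = mk (B' e ++ A' f) ∧ IsReduced (M' e ++ C ++ M' f) := by
    rintro ⟨i, _ | _⟩ ⟨j, _ | _⟩ hij
    · obtain ⟨C, h1, h2⟩ := hpp j i
      refine ⟨invRev C, ?_, ?_⟩
      · rw [← inv_mk, h1, inv_mk]
        simp [A', B', invRev_append]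
      · simpa [M', invRev_append, List.append_assoc] using isReduced_invRev h2
    · exact hnp' i j (by simpa using hij)
    · exact hpn' i j (by simpa using hij)
    · exact hpp i j
  have key := exists_prod_eq_of_core X A' M' hM'
    (fun e => ⟨B' e, (hred' e).infix ⟨A' e, [], by simp⟩, hX' e⟩)
    (fun e f hef => by
      obtain ⟨C, h1, h2⟩ := hCC e f hef
      refine ⟨C, h2, ?_⟩
      rw [hX' e, ← mul_mk (L₁ := A' f), ← mul_mk (L₁ := A' e ++ M' e), ← mul_assoc,
        mul_assoc (mk (A' e ++ M' e)), mul_mk (L₁ := B' e), ← h1]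
      simp [mul_mk])
  have hletter : ∀ y : α, ∃ e, X e = of y := by
    intro y
    have hy : of y ∈ (lift x).range := by
      rw [range_lift_eq_closure, hgen]
      trivial
    obtain ⟨g, hg⟩ := hy
    have hl : IsReduced g.toWord := isReduced_toWord
    have hg' : ((g.toWord).map X).prod = of y := by
      rw [← hg]
      conv_rhs => rw [← mk_toWord (x := g), lift_mk]
    rcases hw : g.toWord with _ | ⟨e, l⟩
    · rw [hw] at hg'
      simp only [List.map_nil, List.prod_nil] at hg'
      exact absurd hg'.symm (of_ne_one y)
    · rw [hw] at hl hg'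
      obtain ⟨R, hlen, hR, h⟩ := key l e hl
      have hAM : IsReduced (A' e ++ M' e) := (hred' e).infix ⟨[], B' e, by simp⟩
      -- The product is a letter, and the core already takes up its length, so `R` is empty and
      -- there is only one factor.
      have hlen2 : (A' e ++ M' e ++ R).length = 1 := by
        rw [← norm_mk_of_isReduced (hAM.append_overlap hR (hM' e)), ← h, hg', norm_of]
      have := List.length_pos_iff.mpr (hM' e)
      simp only [List.length_append] at hlen2
      have hl0 : l = [] := List.length_eq_zero_iff.mp (by omega)
      subst hl0
      exact ⟨e, by simpa using hg'⟩
  choose e he using hletter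
  -- A generator cannot give two letters, since the inverse of a letter is not a letter. Equal
  -- cardinalities then make every generator a letter or its inverse.
  have hinj : Function.Injective fun y => (e y).1 := by
    intro y z hyz
    have h1 := he y
    have h2 := he z
    rcases hy : e y with ⟨i, b⟩
    rcases hz : e z with ⟨j, c⟩
    simp only [hy, hz] at hyz h1 h2
    subst hyz
    have hne : ∀ y z : α, (of y)⁻¹ ≠ of z := by
      intro y z h
      have := congrArg toWord h
      simp [toWord_inv, invRev] at this
    cases b <;> cases c <;> simp only [X, cond_true, cond_false] at h1 h2
    · rw [h1] at h2; exact of_injective h2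
    · rw [h2] at h1; exact absurd h1 (hne _ _)
    · rw [h1] at h2; exact absurd h2 (hne _ _)
    · rw [h1] at h2; exact of_injective h2
  have hsurj := ((Fintype.bijective_iff_injective_and_card _).mpr ⟨hinj, hcard.symm⟩).2
  obtain ⟨y, rfl⟩ := hsurj i
  have h1 : norm (x (e y).1) = 1 := by
    have := he y
    rcases hy : e y with ⟨i, _ | _⟩ <;> rw [hy] at this <;>
      simp only [X, cond_true, cond_false] at this
    · rw [← norm_inv_eq, this, norm_of]
    · rw [this, norm_of]
  rwa [← norm_mk_of_isReduced (hred _)]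

end FreeGroup

/-! ### Positive words: shared prefixes and suffixes -/

namespace FreeGroup

variable {α : Type*}

/-- A positive word, as a word in the letters and their inverses. -/
def posWord (w : List α) : List (α × Bool) := w.map fun x => (x, true)

@[simp] theorem posWord_nil : posWord ([] : List α) = [] := rfl

theorem posWord_append (u v : List α) : posWord (u ++ v) = posWord u ++ posWord v := by
  simp [posWord]

@[simp] theorem posWord_eq_nil {u : List α} : posWord u = [] ↔ u = [] := by
  simp [posWord]

@[simp] theorem length_posWord (u : List α) : (posWord u).length = u.length := by
  simp [posWord]

/-- The element of the free group given by a positive word. -/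
def pos (w : List α) : FreeGroup α := mk (posWord w)

@[simp] theorem pos_nil : pos ([] : List α) = 1 := rfl

@[simp] theorem pos_append (u v : List α) : pos (u ++ v) = pos u * pos v := by
  simp [pos, posWord_append, mul_mk]

theorem isReduced_posWord (u : List α) : IsReduced (posWord u) := by
  induction u with
  | nil => exact IsReduced.nil
  | cons x u ih =>
    cases u with
    | nil => exact IsReduced.singleton
    | cons y u => exact isReduced_cons_cons.mpr ⟨fun _ => rfl, ih⟩

theorem isReduced_pos_neg {u v : List α} (h : u.getLast? ≠ v.getLast?) :
    IsReduced (posWord u ++ invRev (posWord v)) := by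
  refine List.IsChain.append (isReduced_posWord u) (isReduced_invRev (isReduced_posWord v)) ?_
  intro x hx y hy hxy
  simp only [posWord, invRev, List.map_map, List.getLast?_map, List.head?_reverse, Option.mem_def,
    Option.map_eq_some_iff, Function.comp] at hx hy
  obtain ⟨x, hx, rfl⟩ := hx
  obtain ⟨y, hy, rfl⟩ := hy
  simp only at hxy
  subst hxy
  exact absurd (hx.trans hy.symm) h

theorem isReduced_neg_pos {u v : List α} (h : u.head? ≠ v.head?) :
    IsReduced (invRev (posWord u) ++ posWord v) := by
  refine List.IsChain.append (isReduced_invRev (isReduced_posWord u)) (isReduced_posWord v) ?_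
  intro x hx y hy hxy
  simp only [posWord, invRev, List.map_map, List.head?_map, List.getLast?_reverse, Option.mem_def,
    Option.map_eq_some_iff, Function.comp] at hx hy
  obtain ⟨x, hx, rfl⟩ := hx
  obtain ⟨y, hy, rfl⟩ := hy
  simp only at hxy
  subst hxy
  exact absurd (hx.trans hy.symm) h

theorem isReduced_pos_neg_pos {u v w : List α} (h : u.getLast? ≠ v.getLast?)
    (h' : v.head? ≠ w.head?) (hv : v ≠ []) :
    IsReduced (posWord u ++ invRev (posWord v) ++ posWord w) :=
  (isReduced_pos_neg h).append_overlap (isReduced_neg_pos h') fun h => hv (by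
    have := congrArg List.length h
    simpa using this)

variable [DecidableEq α] [Fintype α]

theorem range_fin_three {β : Type*} (f : Fin 3 → β) : Set.range f = {f 0, f 1, f 2} := by
  ext y
  simp [Fin.exists_fin_succ, eq_comm]

/-- Three positive words that generate the free group and have uncancelled cores are letters. -/
theorem length_eq_one_of_positive_core (hα : Fintype.card α = 3) (a m b : Fin 3 → List α)
    (hm : ∀ i, m i ≠ [])
    (hpre : ∀ i j, i < j → ∃ r x y, a i = r ++ x ∧ a j = r ++ y ∧
      (x ++ m i).head? ≠ (y ++ m j).head?)
    (hsuf : ∀ i j, i < j → ∃ r x y, b i = x ++ r ∧ b j = y ++ r ∧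
      (m i ++ x).getLast? ≠ (m j ++ y).getLast?)
    (hgen : Subgroup.closure (Set.range fun i => pos (a i ++ m i ++ b i)) = ⊤) (i : Fin 3) :
    (a i ++ m i ++ b i).length = 1 := by
  have := norm_eq_one_of_core (ι := Fin 3) (by simp [hα]) (fun i => posWord (a i))
    (fun i => posWord (m i)) (fun i => posWord (b i)) (fun i => by simpa using hm i)
    (fun i => by simpa only [posWord_append] using isReduced_posWord (a i ++ m i ++ b i))
    (fun i j => ⟨posWord (b i ++ a j), by rw [posWord_append], by
      simpa only [posWord_append] using isReduced_posWord (m i ++ (b i ++ a j) ++ m j)⟩)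
    (fun i j hij => by
      obtain ⟨r, x, y, hx, hy, h⟩ := hsuf i j hij
      refine ⟨posWord x ++ invRev (posWord y), ?_, ?_⟩
      · simp only [hx, hy, posWord_append, invRev_append, ← mul_mk, ← inv_mk]
        group
      · simpa only [posWord_append, invRev_append, List.append_assoc] using isReduced_pos_neg h)
    (fun i j hij => by
      obtain ⟨r, x, y, hx, hy, h⟩ := hpre i j hij
      refine ⟨invRev (posWord x) ++ posWord y, ?_, ?_⟩
      · simp only [hx, hy, posWord_append, invRev_append, ← mul_mk, ← inv_mk]
        group
      · simpa only [posWord_append, invRev_append, List.append_assoc] using isReduced_neg_pos h)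
    (by simpa only [pos, posWord_append] using hgen) i
  simpa only [← posWord_append, length_posWord] using this

/-- The first two words share a prefix, the last two words share a suffix, without overlap. -/
theorem length_of_distinct_pairs_disjoint (hα : Fintype.card α = 3) {p m t s u w : List α}
    (hu : u ≠ []) (hm : m ≠ []) (hw : w ≠ [])
    (h1 : u.head? ≠ (m ++ t).head?) (h2 : (p ++ u).head? ≠ w.head?)
    (h3 : (p ++ m).head? ≠ w.head?)
    (h4 : u.getLast? ≠ (m ++ t).getLast?) (h5 : u.getLast? ≠ (w ++ t).getLast?)
    (h6 : m.getLast? ≠ w.getLast?)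
    (hgen : Subgroup.closure {pos (p ++ u ++ s), pos (p ++ m ++ t ++ s), pos (w ++ t ++ s)} = ⊤) :
    (p ++ u ++ s).length = 1 ∧ (p ++ m ++ t ++ s).length = 1 ∧ (w ++ t ++ s).length = 1 := by
  have key := length_eq_one_of_positive_core hα ![p, p, []] ![u, m, w] ![s, t ++ s, t ++ s]
    (by intro i; fin_cases i <;> assumption)
    (by
      intro i j hij
      fin_cases i <;> fin_cases j <;> first | exact absurd hij (by decide) | skip
      · refine ⟨p, [], [], by simp, by simp, ?_⟩
        rw [List.head?_append_of_ne_nil _ hm] at h1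
        simpa using h1
      · exact ⟨[], p, [], rfl, rfl, h2⟩
      · exact ⟨[], p, [], rfl, rfl, h3⟩)
    (by
      intro i j hij
      fin_cases i <;> fin_cases j <;> first | exact absurd hij (by decide) | skip
      · refine ⟨s, [], t, by simp, by simp, ?_⟩
        simpa using h4
      · refine ⟨s, [], t, by simp, by simp, ?_⟩
        simpa using h5
      · refine ⟨t ++ s, [], [], by simp, by simp, ?_⟩
        simpa using h6)
    (by
      rw [range_fin_three]
      simpa only [Matrix.cons_val, List.append_assoc, List.nil_append] using hgen)
  exact ⟨by simpa using key 0, by simpa using key 1, by simpa using key 2⟩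

/-- The first two words share a prefix and a suffix, without overlap. -/
theorem length_of_same_pair_disjoint (hα : Fintype.card α = 3) {p m n t s w : List α}
    (hm : m ≠ []) (hn : n ≠ []) (hw : w ≠ [])
    (h1 : m.head? ≠ n.head?) (h2 : (p ++ m).head? ≠ w.head?)
    (h3 : (p ++ n).head? ≠ w.head?)
    (h4 : m.getLast? ≠ n.getLast?) (h5 : (m ++ t).getLast? ≠ w.getLast?)
    (h6 : (n ++ t).getLast? ≠ w.getLast?)
    (hgen : Subgroup.closure {pos (p ++ m ++ t ++ s), pos (p ++ n ++ t ++ s), pos (w ++ s)} = ⊤) :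
    (p ++ m ++ t ++ s).length = 1 ∧ (p ++ n ++ t ++ s).length = 1 ∧ (w ++ s).length = 1 := by
  have key := length_eq_one_of_positive_core hα ![p, p, []] ![m, n, w] ![t ++ s, t ++ s, s]
    (by intro i; fin_cases i <;> assumption)
    (by
      intro i j hij
      fin_cases i <;> fin_cases j <;> first | exact absurd hij (by decide) | skip
      · exact ⟨p, [], [], by simp, by simp, by simpa using h1⟩
      · exact ⟨[], p, [], rfl, rfl, h2⟩
      · exact ⟨[], p, [], rfl, rfl, h3⟩)
    (by
      intro i j hij
      fin_cases i <;> fin_cases j <;> first | exact absurd hij (by decide) | skip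
      · exact ⟨t ++ s, [], [], by simp, by simp, by simpa using h4⟩
      · exact ⟨s, t, [], by simp, by simp, by simpa using h5⟩
      · exact ⟨s, t, [], by simp, by simp, by simpa using h6⟩)
    (by
      rw [range_fin_three]
      simpa only [Matrix.cons_val, List.append_assoc, List.nil_append] using hgen)
  exact ⟨by simpa using key 0, by simpa using key 1, by simpa using key 2⟩

/-- The first two words share a prefix, the last two words share a suffix, and these overlap in
the second word: then the words do not generate. -/
theorem closure_ne_top_of_distinct_pairs_overlap (hα : Fintype.card α = 3)
    {p t u v w s : List α} (hp : p ≠ []) (hu : u ≠ []) (hv : v ≠ []) (hw : w ≠ [])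
    (h1 : w.head? ≠ p.head?) (h2 : u.head? ≠ v.head?)
    (h3 : w.getLast? ≠ p.getLast?) (h4 : u.getLast? ≠ v.getLast?) :
    Subgroup.closure {pos (p ++ t ++ u ++ s), pos (p ++ t ++ v ++ s), pos (w ++ t ++ v ++ s)}
      ≠ ⊤ := by
  intro hgen
  -- Nielsen move: the third word times the inverse of the second is w p⁻¹.
  have hgen' : Subgroup.closure {pos (p ++ t ++ u ++ s), pos (p ++ t ++ v ++ s),
      pos w * (pos p)⁻¹} = ⊤ := by
    rw [eq_top_iff, ← hgen, Subgroup.closure_le]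
    set H := Subgroup.closure {pos (p ++ t ++ u ++ s), pos (p ++ t ++ v ++ s),
      pos w * (pos p)⁻¹}
    have m1 : pos (p ++ t ++ u ++ s) ∈ H := Subgroup.subset_closure (by simp)
    have m2 : pos (p ++ t ++ v ++ s) ∈ H := Subgroup.subset_closure (by simp)
    have m3 : pos w * (pos p)⁻¹ ∈ H := Subgroup.subset_closure (by simp)
    rintro x (rfl | rfl | rfl)
    · exact m1
    · exact m2
    · change _ ∈ H
      have := H.mul_mem m3 m2
      simp only [pos_append] at this ⊢
      convert this using 1
      group
  have hW := posWord_append (α := α)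
  have key := norm_eq_one_of_core (ι := Fin 3) (by simp [hα])
    ![posWord (p ++ t), posWord (p ++ t), []]
    ![posWord u, posWord v, posWord w]
    ![posWord s, posWord s, invRev (posWord p)]
    (by intro i; fin_cases i <;> simpa)
    (by
      intro i
      fin_cases i
      · simpa [hW] using isReduced_posWord (p ++ t ++ u ++ s)
      · simpa [hW] using isReduced_posWord (p ++ t ++ v ++ s)
      · simpa using isReduced_pos_neg h3)
    (by
      have e : ∀ x y : List α, IsReduced (posWord x ++ posWord (s ++ p ++ t) ++ posWord y) :=
        fun x y => by simpa [hW] using isReduced_posWord (x ++ (s ++ p ++ t) ++ y)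
      intro i j
      fin_cases i <;> fin_cases j
      · exact ⟨posWord (s ++ p ++ t), by simp [hW], e _ _⟩
      · exact ⟨posWord (s ++ p ++ t), by simp [hW], e _ _⟩
      · exact ⟨posWord s, by simp, by simpa [hW] using isReduced_posWord (u ++ s ++ w)⟩
      · exact ⟨posWord (s ++ p ++ t), by simp [hW], e _ _⟩
      · exact ⟨posWord (s ++ p ++ t), by simp [hW], e _ _⟩
      · exact ⟨posWord s, by simp, by simpa [hW] using isReduced_posWord (v ++ s ++ w)⟩
      · exact ⟨posWord t, by simp [hW, ← mul_mk, ← inv_mk], by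
          simpa [hW] using isReduced_posWord (w ++ t ++ u)⟩
      · exact ⟨posWord t, by simp [hW, ← mul_mk, ← inv_mk], by
          simpa [hW] using isReduced_posWord (w ++ t ++ v)⟩
      -- In the square of w p⁻¹ nothing cancels: p⁻¹ stays whole between the two cores.
      · exact ⟨invRev (posWord p), by simp, isReduced_pos_neg_pos h3 h1.symm hp⟩)
    (by
      have e : ∀ x : List α, IsReduced (posWord x ++ posWord (s ++ p) ++ invRev (posWord w)) := by
        intro x
        have := isReduced_pos_neg (u := x ++ s ++ p) (v := w) (by
          rw [List.getLast?_append_of_ne_nil _ hp]; exact h3.symm)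
        simpa [hW] using this
      intro i j hij
      fin_cases i <;> fin_cases j <;> first | exact absurd hij (by decide) | skip
      · exact ⟨[], by simp [← mul_mk, ← inv_mk]; rfl, by simpa using isReduced_pos_neg h4⟩
      · exact ⟨posWord (s ++ p), by simp [hW], e _⟩
      · exact ⟨posWord (s ++ p), by simp [hW], e _⟩)
    (by
      have e : ∀ x : List α, IsReduced (invRev (posWord x) ++ invRev (posWord (p ++ t)) ++
          posWord w) := by
        intro x
        have := isReduced_neg_pos (u := p ++ t ++ x) (v := w) (by
          rw [List.append_assoc, List.head?_append_of_ne_nil _ hp]; exact h1.symm)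
        simpa [hW, invRev_append] using this
      intro i j hij
      fin_cases i <;> fin_cases j <;> first | exact absurd hij (by decide) | skip
      · exact ⟨[], by simp [← mul_mk, ← inv_mk]; rfl, by simpa using isReduced_neg_pos h2⟩
      · exact ⟨invRev (posWord (p ++ t)), by simp, e _⟩
      · exact ⟨invRev (posWord (p ++ t)), by simp, e _⟩)
    (by
      rw [range_fin_three]
      simpa [pos, hW, ← mul_mk, ← inv_mk, mul_assoc] using hgen') 0
  -- The first word should be a letter, but it contains both p and u.
  have hp' := List.length_pos_iff.mpr hp
  have hu' := List.length_pos_iff.mpr hu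
  simp at key
  omega

end FreeGroup

/-! ### One pair sharing an overlapping prefix and suffix -/

namespace FreeGroup

variable {α : Type*} [DecidableEq α] [Fintype α]

/-- The second word is (p o y p⁻¹)(p o t s). Replacing it by p o y p⁻¹ gives generators with cores
y, t, w, among which p o t s has at least two letters. -/
theorem closure_ne_top_of_same_pair_short_overlap (hα : Fintype.card α = 3)
    {p o y t w s : List α} (hp : p ≠ []) (hy : y ≠ []) (ht : t ≠ []) (hw : w ≠ [])
    (h1 : y.head? ≠ t.head?) (h2 : y.getLast? ≠ p.getLast?)
    (h3 : w.head? ≠ p.head?) (h4 : w.getLast? ≠ t.getLast?) :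
    Subgroup.closure {pos (p ++ o ++ t ++ s), pos (p ++ o ++ y ++ o ++ t ++ s), pos (w ++ s)}
      ≠ ⊤ := by
  intro hgen
  have hgen' : Subgroup.closure {pos (p ++ o ++ y) * (pos p)⁻¹, pos (p ++ o ++ t ++ s),
      pos (w ++ s)} = ⊤ := by
    rw [eq_top_iff, ← hgen, Subgroup.closure_le]
    set H := Subgroup.closure {pos (p ++ o ++ y) * (pos p)⁻¹, pos (p ++ o ++ t ++ s), pos (w ++ s)}
    have m1 : pos (p ++ o ++ y) * (pos p)⁻¹ ∈ H := Subgroup.subset_closure (by simp)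
    have m2 : pos (p ++ o ++ t ++ s) ∈ H := Subgroup.subset_closure (by simp)
    have m3 : pos (w ++ s) ∈ H := Subgroup.subset_closure (by simp)
    rintro x (rfl | rfl | rfl)
    · exact m2
    · change _ ∈ H
      have := H.mul_mem m1 m2
      simp only [pos_append] at this ⊢
      convert this using 1
      group
    · exact m3
  have hW := posWord_append (α := α)
  have key := norm_eq_one_of_core (ι := Fin 3) (by simp [hα])
    ![posWord (p ++ o), posWord (p ++ o), []]
    ![posWord y, posWord t, posWord w]
    ![invRev (posWord p), posWord s, posWord s]
    (by intro i; fin_cases i <;> simpa)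
    (by
      intro i
      fin_cases i
      · have := isReduced_pos_neg (u := p ++ o ++ y) (v := p) (by
          rwa [List.getLast?_append_of_ne_nil _ hy])
        simpa [hW] using this
      · simpa [hW] using isReduced_posWord (p ++ o ++ t ++ s)
      · simpa [hW] using isReduced_posWord (w ++ s))
    (by
      have e : ∀ x y z : List α, IsReduced (posWord x ++ posWord y ++ posWord z) :=
        fun x y z => by simpa [hW] using isReduced_posWord (x ++ y ++ z)
      intro i j
      fin_cases i <;> fin_cases j
      · exact ⟨posWord o, by simp [hW, ← mul_mk, ← inv_mk], e _ _ _⟩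
      · exact ⟨posWord o, by simp [hW, ← mul_mk, ← inv_mk], e _ _ _⟩
      · exact ⟨invRev (posWord p), by simp, isReduced_pos_neg_pos h2 h3.symm hp⟩
      · exact ⟨posWord (s ++ p ++ o), by simp [hW], e _ _ _⟩
      · exact ⟨posWord (s ++ p ++ o), by simp [hW], e _ _ _⟩
      · exact ⟨posWord s, by simp, e _ _ _⟩
      · exact ⟨posWord (s ++ p ++ o), by simp [hW], e _ _ _⟩
      · exact ⟨posWord (s ++ p ++ o), by simp [hW], e _ _ _⟩
      · exact ⟨posWord s, by simp, e _ _ _⟩)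
    (by
      have e : ∀ x : List α, IsReduced (posWord y ++ invRev (posWord (s ++ p)) ++
          invRev (posWord x)) := by
        intro x
        have := isReduced_pos_neg (u := y) (v := x ++ s ++ p) (by
          rwa [List.getLast?_append_of_ne_nil _ hp])
        simpa [hW, invRev_append] using this
      intro i j hij
      fin_cases i <;> fin_cases j <;> first | exact absurd hij (by decide) | skip
      · exact ⟨invRev (posWord (s ++ p)), by simp [hW, invRev_append], e _⟩
      · exact ⟨invRev (posWord (s ++ p)), by simp [hW, invRev_append], e _⟩
      · exact ⟨[], by simp [← mul_mk, ← inv_mk]; rfl, by simpa using isReduced_pos_neg h4.symm⟩)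
    (by
      have e : ∀ x : List α, IsReduced (invRev (posWord x) ++ invRev (posWord (p ++ o)) ++
          posWord w) := by
        intro x
        have := isReduced_neg_pos (u := p ++ o ++ x) (v := w) (by
          rw [List.append_assoc, List.head?_append_of_ne_nil _ hp]; exact h3.symm)
        simpa [hW, invRev_append] using this
      intro i j hij
      fin_cases i <;> fin_cases j <;> first | exact absurd hij (by decide) | skip
      · exact ⟨[], by simp [← mul_mk, ← inv_mk]; rfl, by simpa using isReduced_neg_pos h1⟩
      · exact ⟨invRev (posWord (p ++ o)), by simp, e _⟩
      · exact ⟨invRev (posWord (p ++ o)), by simp, e _⟩)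
    (by
      rw [range_fin_three]
      simpa [pos, hW, ← mul_mk, ← inv_mk, mul_assoc] using hgen') 1
  have hp' := List.length_pos_iff.mpr hp
  have ht' := List.length_pos_iff.mpr ht
  simp at key
  omega

/-- The first two words share a prefix and a suffix, and these overlap: then the words do not
generate. -/
theorem closure_ne_top_of_same_pair_overlap (hα : Fintype.card α = 3)
    {p t z z' w s : List α} (o : List α) (hp : p ≠ []) (ht : t ≠ []) (hz' : z' ≠ []) (hw : w ≠ [])
    (ho : o ++ z = z' ++ o)
    (h1 : z.head? ≠ t.head?) (h2 : z'.getLast? ≠ p.getLast?)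
    (h3 : w.head? ≠ p.head?) (h4 : w.getLast? ≠ t.getLast?) :
    Subgroup.closure {pos (p ++ o ++ t ++ s), pos (p ++ o ++ z ++ t ++ s), pos (w ++ s)} ≠ ⊤ := by
  -- A Euclidean algorithm on o z = z' o: remove z' from o until the remaining overlap is no longer
  -- than z'.
  induction hn : o.length using Nat.strong_induction_on generalizing o with
  | _ n ih =>
  subst hn
  rcases List.append_eq_append_iff.mp ho with ⟨y, hy, hz⟩ | ⟨o', ho', hz⟩
  · rcases eq_or_ne y [] with rfl | hy0
    -- Here z' = z = o, and one more reduction makes the overlap empty.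
    · simp only [List.append_nil] at hy
      subst hy
      have hzo : z' = z := by simpa using hz.symm
      subst hzo
      have := closure_ne_top_of_same_pair_short_overlap hα (o := []) (s := s) hp hz' ht hw h1 h2
        h3 h4
      intro hgen
      refine this (top_le_iff.mp ?_)
      rw [← hgen, Subgroup.closure_le]
      set H := Subgroup.closure {pos (p ++ [] ++ t ++ s), pos (p ++ [] ++ z' ++ [] ++ t ++ s),
        pos (w ++ s)}
      have m1 : pos (p ++ [] ++ t ++ s) ∈ H := Subgroup.subset_closure (by simp)
      have m2 : pos (p ++ [] ++ z' ++ [] ++ t ++ s) ∈ H := Subgroup.subset_closure (by simp)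
      have m3 : pos (w ++ s) ∈ H := Subgroup.subset_closure (by simp)
      rintro x (rfl | rfl | rfl)
      · simpa using m2
      · change _ ∈ H
        have := H.mul_mem (H.mul_mem m2 (H.inv_mem m1)) m2
        simp only [pos_append, pos_nil] at this ⊢
        convert this using 1
        group
      · exact m3
    · subst hy hz
      rw [List.head?_append_of_ne_nil _ hy0] at h1
      rw [List.getLast?_append_of_ne_nil _ hy0] at h2
      simpa only [List.append_assoc] using
        closure_ne_top_of_same_pair_short_overlap hα (o := o) (s := s) hp hy0 ht hw h1 h2 h3 h4
  -- Here o = z' o' = o' z. With U = p o' t s and V = p o' z t s, the first two words are V and V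
  -- U⁻¹ V.
  · have hlt : o'.length < o.length := by
      have := List.length_pos_iff.mpr hz'
      rw [ho', List.length_append]
      omega
    have hcomm : o' ++ z = z' ++ o' := by rw [← hz, ← ho']
    have := ih _ hlt o' hcomm rfl
    intro hgen
    refine this (top_le_iff.mp ?_)
    rw [← hgen, Subgroup.closure_le]
    set H := Subgroup.closure {pos (p ++ o' ++ t ++ s), pos (p ++ o' ++ z ++ t ++ s), pos (w ++ s)}
    have m1 : pos (p ++ o' ++ t ++ s) ∈ H := Subgroup.subset_closure (by simp)
    have m2 : pos (p ++ o' ++ z ++ t ++ s) ∈ H := Subgroup.subset_closure (by simp)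
    have m3 : pos (w ++ s) ∈ H := Subgroup.subset_closure (by simp)
    have hc : pos z' = pos o' * pos z * (pos o')⁻¹ := by
      rw [← pos_append, hcomm, pos_append, mul_inv_cancel_right]
    rw [ho']
    rintro x (rfl | rfl | rfl)
    · change _ ∈ H
      simp only [pos_append] at m2 ⊢
      rw [hc]
      convert m2 using 1
      group
    · change _ ∈ H
      have := H.mul_mem (H.mul_mem m2 (H.inv_mem m1)) m2
      simp only [pos_append] at this ⊢
      rw [hc]
      convert this using 1
      group
    · exact m3

/-- Inside v, the prefix shared with u and the suffix shared with w either leave a gap, which is the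
core of v, or meet or overlap, which contradicts generation. -/
theorem length_eq_one_of_distinct_pairs (hα : Fintype.card α = 3)
    {u v w s p u₁ v₁ t v₂ w₂ : List α} (hu : u = p ++ u₁) (hv : v = p ++ v₁)
    (hv' : v = v₂ ++ t) (hw' : w = w₂ ++ t) (hu₁ : u₁ ≠ []) (hv₁ : v₁ ≠ []) (hv₂ : v₂ ≠ [])
    (hw₂ : w₂ ≠ []) (h1 : u₁.head? ≠ v₁.head?) (h2 : v₂.getLast? ≠ w₂.getLast?)
    (h3 : w.head? ≠ u.head?) (h4 : w.head? ≠ v.head?)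
    (h5 : u.getLast? ≠ v.getLast?) (h6 : u.getLast? ≠ w.getLast?)
    (hgen : Subgroup.closure {pos (u ++ s), pos (v ++ s), pos (w ++ s)} = ⊤) :
    (u ++ s).length = 1 ∧ (v ++ s).length = 1 ∧ (w ++ s).length = 1 := by
  have h4' := h4
  rw [hv', hw', List.head?_append_of_ne_nil _ hv₂, List.head?_append_of_ne_nil _ hw₂] at h4'
  have h5' := h5
  rw [hu, hv, List.getLast?_append_of_ne_nil _ hu₁, List.getLast?_append_of_ne_nil _ hv₁] at h5'
  have hov : ∀ x, p = v₂ ++ x → t = x ++ v₁ → False := by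
    rintro x rfl rfl
    refine closure_ne_top_of_distinct_pairs_overlap hα (p := v₂) (t := x) (u := u₁) (v := v₁)
      (w := w₂) (s := s) hv₂ hu₁ hv₁ hw₂ h4' h1 h2.symm h5' ?_
    simpa [hu, hv, hw'] using hgen
  rcases List.append_eq_append_iff.mp (hv.symm.trans hv') with ⟨m, hm1, hm2⟩ | ⟨x, hx1, hx2⟩
  · rcases eq_or_ne m [] with rfl | hm
    · exact (hov [] (by simpa using hm1.symm) (by simpa using hm2.symm)).elim
    · subst hm1 hm2
      rw [List.getLast?_append_of_ne_nil _ hm] at h2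
      have := length_of_distinct_pairs_disjoint hα (p := p) (t := t) (s := s) hu₁ hm hw₂ h1
        (by rw [hu, hw', List.head?_append_of_ne_nil _ hw₂] at h3; exact h3.symm) h4'.symm h5'
        (by
          rw [hu, hw', List.getLast?_append_of_ne_nil _ hu₁] at h6
          exact h6) h2
        (by simpa [hu, hv', hw'] using hgen)
      simpa [hu, hv', hw'] using this
  · exact (hov x hx1 hx2).elim

/-- Only the shorter word u matters: a gap between p and t in u forces one in v. If p and t overlap
in u along o, reading v from both ends yields v = u₂ o z u₁ = u₂ z' o u₁, hence o z = z' o. -/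
theorem length_eq_one_of_same_pair (hα : Fintype.card α = 3)
    {u v w s p u₁ v₁ t u₂ v₂ : List α} (hu : u = p ++ u₁) (hv : v = p ++ v₁)
    (hu' : u = u₂ ++ t) (hv' : v = v₂ ++ t) (hu₁ : u₁ ≠ []) (hv₁ : v₁ ≠ []) (hu₂ : u₂ ≠ [])
    (hv₂ : v₂ ≠ []) (hw : w ≠ []) (h1 : u₁.head? ≠ v₁.head?) (h2 : u₂.getLast? ≠ v₂.getLast?)
    (h3 : w.head? ≠ u.head?) (h4 : w.head? ≠ v.head?)
    (h5 : w.getLast? ≠ u.getLast?) (h6 : w.getLast? ≠ v.getLast?)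
    (hle : u.length ≤ v.length)
    (hgen : Subgroup.closure {pos (u ++ s), pos (v ++ s), pos (w ++ s)} = ⊤) :
    (u ++ s).length = 1 ∧ (v ++ s).length = 1 ∧ (w ++ s).length = 1 := by
  have h3' := h3
  rw [hu', List.head?_append_of_ne_nil _ hu₂] at h3'
  have h5' := h5
  rw [hu, List.getLast?_append_of_ne_nil _ hu₁] at h5'
  have hov : ∀ o, p = u₂ ++ o → t = o ++ u₁ → False := by
    intro o hp ht
    obtain ⟨z, hz1, hz2⟩ : ∃ z, v₂ ++ o = u₂ ++ o ++ z ∧ v₁ = z ++ u₁ := by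
      have e : (u₂ ++ o) ++ v₁ = (v₂ ++ o) ++ u₁ := by
        rw [← hp, ← hv, hv', ht, List.append_assoc]
      rcases List.append_eq_append_iff.mp e with ⟨z, hz1, hz2⟩ | ⟨z, hz1, hz2⟩
      · exact ⟨z, hz1, hz2⟩
      -- This order of the factors would make v shorter than u unless z is empty.
      · have hz : z = [] := by
          have e1 := congrArg List.length hz2
          rw [hu, hv] at hle
          simp only [List.length_append] at hle e1
          exact List.length_eq_zero_iff.mp (by omega)
        subst hz
        exact ⟨[], by simpa using hz1.symm, by simpa using hz2.symm⟩
    have hz : z ≠ [] := by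
      rintro rfl
      exact h1 (by simp [hz2])
    obtain ⟨z', hz'1, hz'2⟩ : ∃ z', v₂ = u₂ ++ z' ∧ o ++ z = z' ++ o := by
      rw [List.append_assoc] at hz1
      rcases List.append_eq_append_iff.mp hz1 with ⟨x, hx1, hx2⟩ | ⟨z', hx1, hx2⟩
      · have e1 := congrArg List.length hx2
        have := List.length_pos_iff.mpr hz
        simp only [List.length_append] at e1
        omega
      · exact ⟨z', hx1, hx2⟩
    have hz' : z' ≠ [] := by
      rintro rfl
      exact h2 (by simp [hz'1])
    refine closure_ne_top_of_same_pair_overlap hα (p := u₂) (t := u₁) (z := z) (z' := z')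
      (w := w) (s := s) o hu₂ hu₁ hz' hw hz'2 ?_ ?_ h3' h5' ?_
    · rw [hz2, List.head?_append_of_ne_nil _ hz] at h1
      exact h1.symm
    · rw [hz'1, List.getLast?_append_of_ne_nil _ hz'] at h2
      exact h2.symm
    · simpa [hu, hv, hp, hz2] using hgen
  rcases List.append_eq_append_iff.mp (hu.symm.trans hu') with ⟨m, hm1, hm2⟩ | ⟨x, hx1, hx2⟩
  · rcases eq_or_ne m [] with rfl | hm
    · exact (hov [] (by simpa using hm1.symm) (by simpa using hm2.symm)).elim
    · have hmpos := List.length_pos_iff.mpr hm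
      obtain ⟨n, hn1, hn2, hn⟩ : ∃ n, v₂ = p ++ n ∧ v₁ = n ++ t ∧ n ≠ [] := by
        rw [hu', hv'] at hle
        rcases List.append_eq_append_iff.mp (hv.symm.trans hv') with ⟨n, hn1, hn2⟩ | ⟨x, hx1, hx2⟩
        · refine ⟨n, hn1, hn2, ?_⟩
          rintro rfl
          simp only [hm1, hn1, List.length_append, List.length_nil] at hle
          omega
        · have e1 := congrArg List.length hx1
          simp only [hm1, List.length_append] at hle e1
          omega
      have := length_of_same_pair_disjoint hα (p := p) (t := t) (s := s) hm hn hw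
        (by
          rw [hm2, hn2, List.head?_append_of_ne_nil _ hm, List.head?_append_of_ne_nil _ hn] at h1
          exact h1)
        (by rw [← hm1]; exact h3'.symm)
        (by rw [← hn1]; rw [hv', List.head?_append_of_ne_nil _ hv₂] at h4; exact h4.symm)
        (by
          rw [hm1, hn1, List.getLast?_append_of_ne_nil _ hm,
            List.getLast?_append_of_ne_nil _ hn] at h2
          exact h2)
        (by rw [← hm2]; exact h5'.symm)
        (by rw [← hn2]; rw [hv, List.getLast?_append_of_ne_nil _ hv₁] at h6; exact h6.symm)
        (by simpa [hu', hv', hm1, hn1] using hgen)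
      simpa [hu', hv', hm1, hn1] using this
  · exact (hov x hx1 hx2).elim

end FreeGroup

/-! ### Three letters -/

instance : Fintype Letter := ⟨{Letter.a, Letter.b, Letter.c}, fun x => by cases x <;> decide⟩

theorem Letter.card : Fintype.card Letter = 3 := rfl

theorem Letter.range_eq {β : Type*} (f : Letter → β) {i j k : Letter} (hij : i ≠ j) (hik : i ≠ k)
    (hjk : j ≠ k) : Set.range f = {f i, f j, f k} := by
  have hx : ∀ x : Letter, x = i ∨ x = j ∨ x = k := by
    revert hij hik hjk
    cases i <;> cases j <;> cases k <;> intro h1 h2 h3 x <;> cases x <;> simp_all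
  ext y
  constructor
  · rintro ⟨x, rfl⟩
    rcases hx x with rfl | rfl | rfl <;> simp
  · rintro (rfl | rfl | rfl) <;> exact ⟨_, rfl⟩

theorem Letter.exists_two_ne (k : Letter) : ∃ i j, i ≠ j ∧ i ≠ k ∧ j ≠ k := by
  cases k
  · exact ⟨.b, .c, by simp⟩
  · exact ⟨.a, .c, by simp⟩
  · exact ⟨.a, .b, by simp⟩

theorem Letter.exists_third {i k : Letter} (h : i ≠ k) : ∃ j, j ≠ i ∧ j ≠ k := by
  cases i <;> cases k <;> first | exact absurd rfl h | skip
  exacts [⟨.c, by simp⟩, ⟨.b, by simp⟩, ⟨.c, by simp⟩, ⟨.a, by simp⟩, ⟨.b, by simp⟩, ⟨.a, by simp⟩]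

/-- A non-constant function on the three letters takes at some letter a value that it does not
take elsewhere. -/
theorem Letter.exists_odd_value {β : Type*} (f : Letter → β) (hf : ¬∃ v, ∀ x, f x = v) :
    ∃ k, ∀ i, i ≠ k → f k ≠ f i := by
  by_contra! h
  obtain ⟨i, hi, hfi⟩ := h .a
  apply hf
  obtain ⟨k, hk, hka⟩ := Letter.exists_third hi.symm
  obtain ⟨j, hj, hfj⟩ := h k
  refine ⟨f .a, fun x => ?_⟩
  cases i <;> cases k <;> cases j <;> cases x <;> simp_all

/-! ### Common prefixes and suffixes of words -/

namespace List

variable {α : Type*}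

theorem exists_prefix_decomposition (u v : List α) :
    ∃ p x y, u = p ++ x ∧ v = p ++ y ∧ (x = [] ∨ y = [] ∨ x.head? ≠ y.head?) := by
  induction u generalizing v with
  | nil => exact ⟨[], [], v, rfl, rfl, Or.inl rfl⟩
  | cons a u ih =>
    cases v with
    | nil => exact ⟨[], _, [], rfl, rfl, by simp⟩
    | cons b v =>
      by_cases hab : a = b
      · subst hab
        obtain ⟨p, x, y, rfl, rfl, h⟩ := ih v
        exact ⟨a :: p, x, y, rfl, rfl, h⟩
      · exact ⟨[], _, _, rfl, rfl, by simp [hab]⟩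

theorem exists_prefix_of_not_isPrefix {u v : List α} (h1 : ¬u <+: v) (h2 : ¬v <+: u) :
    ∃ p x y, u = p ++ x ∧ v = p ++ y ∧ x ≠ [] ∧ y ≠ [] ∧ x.head? ≠ y.head? := by
  obtain ⟨p, x, y, rfl, rfl, h⟩ := exists_prefix_decomposition u v
  have hx : x ≠ [] := by rintro rfl; simp at h1
  have hy : y ≠ [] := by rintro rfl; simp at h2
  exact ⟨p, x, y, rfl, rfl, hx, hy, by simpa [hx, hy] using h⟩

theorem exists_suffix_of_not_isSuffix {u v : List α} (h1 : ¬u <:+ v) (h2 : ¬v <:+ u) :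
    ∃ t x y, u = x ++ t ∧ v = y ++ t ∧ x ≠ [] ∧ y ≠ [] ∧ x.getLast? ≠ y.getLast? := by
  rw [← reverse_prefix] at h1 h2
  obtain ⟨p, x, y, hu, hv, hx, hy, h⟩ := exists_prefix_of_not_isPrefix h1 h2
  refine ⟨p.reverse, x.reverse, y.reverse, ?_, ?_, by simpa, by simpa, by simpa using h⟩
  · rw [← reverse_append, ← hu, reverse_reverse]
  · rw [← reverse_append, ← hv, reverse_reverse]

/-- Strip the longest common prefix off a family of words. -/
theorem exists_common_prefix {ι : Type*} (i : ι) (f : ι → List α) :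
    ∃ (c : List α) (g : ι → List α), (∀ x, f x = c ++ g x) ∧ ¬∃ y, ∀ x, (g x).head? = some y := by
  induction hn : (f i).length generalizing f with
  | zero =>
    refine ⟨[], f, fun _ => rfl, ?_⟩
    rintro ⟨y, hy⟩
    have := hy i
    rw [length_eq_zero_iff.mp hn] at this
    simp at this
  | succ n ih =>
    by_cases h : ∃ y, ∀ x, (f x).head? = some y
    · obtain ⟨y, hy⟩ := h
      have hf : ∀ x, f x = y :: (f x).tail := fun x => eq_cons_of_mem_head? (hy x)
      obtain ⟨c, g, hg, h⟩ := ih (fun x => (f x).tail) (by simp [hn])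
      refine ⟨y :: c, g, fun x => ?_, h⟩
      rw [hf x, hg x, cons_append]
    · exact ⟨[], f, fun _ => rfl, h⟩

/-- Strip the longest common suffix off a family of words. -/
theorem exists_common_suffix {ι : Type*} (i : ι) (f : ι → List α) :
    ∃ (d : List α) (g : ι → List α), (∀ x, f x = g x ++ d) ∧ ¬∃ y, ∀ x, (g x).getLast? = some y := by
  obtain ⟨c, g, hg, h⟩ := exists_common_prefix i fun x => (f x).reverse
  refine ⟨c.reverse, fun x => (g x).reverse, fun x => ?_, by simpa using h⟩
  rw [← reverse_append, ← hg, reverse_reverse]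

end List

/-! ### Irreducible triples consist of letters -/

open FreeGroup in
/-- A generating triple of positive words with trivial common prefix and none of which is a prefix
or a suffix of another one consists of letters, also after a common suffix is added. -/
theorem length_eq_one_of_no_prefix_no_suffix (ρ : Letter → List Letter) (s : List Letter)
    (h0 : ∀ x, ρ x ≠ []) (hhead : ¬∃ y, ∀ x, (ρ x).head? = some y)
    (hlast : ¬∃ y, ∀ x, (ρ x).getLast? = some y)
    (hpre : ∀ i j, i ≠ j → ¬ρ i <+: ρ j) (hsuf : ∀ i j, i ≠ j → ¬ρ i <:+ ρ j)
    (hgen : Subgroup.closure (Set.range fun x => pos (ρ x ++ s)) = ⊤) (x : Letter) :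
    (ρ x ++ s).length = 1 := by
  suffices ∃ i j k : Letter, i ≠ j ∧ i ≠ k ∧ j ≠ k ∧ (ρ i ++ s).length = 1 ∧
      (ρ j ++ s).length = 1 ∧ (ρ k ++ s).length = 1 by
    obtain ⟨i, j, k, hij, hik, hjk, hi, hj, hk⟩ := this
    have hmem : (ρ x ++ s).length ∈ Set.range fun x => (ρ x ++ s).length := ⟨x, rfl⟩
    rw [Letter.range_eq _ hij hik hjk] at hmem
    rcases hmem with h | h | h
    · exact h.trans hi
    · exact h.trans hj
    · exact h.trans hk
  obtain ⟨k, hk⟩ := Letter.exists_odd_value (fun x => (ρ x).head?) (by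
    rintro ⟨v, hv⟩
    cases v with
    | none => exact h0 .a (List.head?_eq_none_iff.mp (hv .a))
    | some y => exact hhead ⟨y, hv⟩)
  obtain ⟨l, hl⟩ := Letter.exists_odd_value (fun x => (ρ x).getLast?) (by
    rintro ⟨v, hv⟩
    cases v with
    | none => exact h0 .a (List.getLast?_eq_none_iff.mp (hv .a))
    | some y => exact hlast ⟨y, hv⟩)
  -- Only words other than `k` can share a first letter, and only words other than `l` a last one.
  -- If `l = k` this is one pair; otherwise the third word belongs to both pairs.
  by_cases hkl : l = k
  · subst hkl
    obtain ⟨i, j, hij, hil, hjl, hle⟩ : ∃ i j, i ≠ j ∧ i ≠ l ∧ j ≠ l ∧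
        (ρ i).length ≤ (ρ j).length := by
      obtain ⟨i, j, hij, hil, hjl⟩ := Letter.exists_two_ne l
      rcases le_total (ρ i).length (ρ j).length with h | h
      · exact ⟨i, j, hij, hil, hjl, h⟩
      · exact ⟨j, i, hij.symm, hjl, hil, h⟩
    obtain ⟨p, u₁, v₁, hu, hv, hu₁, hv₁, h1⟩ :=
      List.exists_prefix_of_not_isPrefix (hpre i j hij) (hpre j i hij.symm)
    obtain ⟨t, u₂, v₂, hu', hv', hu₂, hv₂, h2⟩ :=
      List.exists_suffix_of_not_isSuffix (hsuf i j hij) (hsuf j i hij.symm)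
    refine ⟨i, j, l, hij, hil, hjl, ?_⟩
    rw [Letter.range_eq _ hij hil hjl] at hgen
    exact length_eq_one_of_same_pair Letter.card hu hv hu' hv' hu₁ hv₁ hu₂ hv₂ (h0 l) h1 h2
      (hk i hil) (hk j hjl) (hl i hil) (hl j hjl) hle hgen
  · obtain ⟨j, hjl, hjk⟩ := Letter.exists_third hkl
    obtain ⟨p, u₁, v₁, hu, hv, hu₁, hv₁, h1⟩ :=
      List.exists_prefix_of_not_isPrefix (hpre l j hjl.symm) (hpre j l hjl)
    obtain ⟨t, v₂, w₂, hv', hw', hv₂, hw₂, h2⟩ :=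
      List.exists_suffix_of_not_isSuffix (hsuf j k hjk) (hsuf k j hjk.symm)
    refine ⟨l, j, k, hjl.symm, hkl, hjk, ?_⟩
    rw [Letter.range_eq _ hjl.symm hkl hjk] at hgen
    exact length_eq_one_of_distinct_pairs Letter.card hu hv hv' hw' hu₁ hv₁ hv₂ hw₂ h1 h2
      (hk l hkl) (hk j hjk) (hl j hjl) (hl k (Ne.symm hkl)) hgen

/-! ### Substitutions, their extensions and the elementary factors -/

open FreeGroup (pos pos_nil pos_append)

theorem wordToGroup_eq_pos (u : FreeMonoid Letter) : wordToGroup u = pos u.toList := by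
  induction u using FreeMonoid.inductionOn' with
  | one => rfl
  | of_mul x u ih =>
    rw [map_mul, ih, FreeMonoid.toList_of_mul, ← List.singleton_append, pos_append]
    rfl

namespace Substitution

/-- The endomorphism of the free group that maps the letter `x` to the positive word `f x`. -/
def wordsHom (f : Letter → List Letter) : FreeGroup Letter →* FreeGroup Letter :=
  FreeGroup.lift fun x => pos (f x)

@[simp] theorem wordsHom_of (f : Letter → List Letter) (x : Letter) :
    wordsHom f (FreeGroup.of x) = pos (f x) := by
  simp [wordsHom]

theorem extend_of (σ : Substitution) (x : Letter) :
    σ.extend (FreeGroup.of x) = wordToGroup (σ (FreeMonoid.of x)) := by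
  simp [extend]

theorem extend_eq_wordsHom (σ : Substitution) :
    σ.extend = wordsHom fun x => (σ (FreeMonoid.of x)).toList := by
  refine FreeGroup.ext_hom _ _ fun x => ?_
  rw [extend_of, wordsHom_of, wordToGroup_eq_pos]

theorem extend_wordToGroup (σ : Substitution) (u : FreeMonoid Letter) :
    σ.extend (wordToGroup u) = wordToGroup (σ u) := by
  have : σ.extend.comp wordToGroup = wordToGroup.comp σ :=
    FreeMonoid.hom_eq fun x => extend_of σ x
  exact DFunLike.congr_fun this u

theorem extend_mul (σ τ : Substitution) : (σ * τ).extend = σ.extend.comp τ.extend := by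
  refine FreeGroup.ext_hom _ _ fun x => ?_
  rw [MonoidHom.comp_apply, extend_of, extend_of, extend_wordToGroup]
  rfl

/-- The substitution that maps `j` to `ij` and fixes the other letters. -/
def elemL (i j : Letter) : Substitution :=
  FreeMonoid.lift fun x =>
    if x = j then FreeMonoid.of i * FreeMonoid.of j else FreeMonoid.of x

/-- The substitution that maps `j` to `ji` and fixes the other letters. -/
def elemR (i j : Letter) : Substitution :=
  FreeMonoid.lift fun x =>
    if x = j then FreeMonoid.of j * FreeMonoid.of i else FreeMonoid.of x

theorem elemL_of (i j x : Letter) : elemL i j (FreeMonoid.of x) =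
    if x = j then FreeMonoid.of i * FreeMonoid.of j else FreeMonoid.of x :=
  FreeMonoid.lift_eval_of _ _

theorem elemR_of (i j x : Letter) : elemR i j (FreeMonoid.of x) =
    if x = j then FreeMonoid.of j * FreeMonoid.of i else FreeMonoid.of x :=
  FreeMonoid.lift_eval_of _ _

theorem ofTriple_of (u v w : FreeMonoid Letter) (x : Letter) :
    ofTriple u v w (FreeMonoid.of x) = match x with
      | Letter.a => u
      | Letter.b => v
      | Letter.c => w :=
  FreeMonoid.lift_eval_of _ _

theorem ofPerm_of (π : Equiv.Perm Letter) (x : Letter) :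
    ofPerm π (FreeMonoid.of x) = FreeMonoid.of (π x) :=
  rfl

@[simp] theorem wordToGroup_of (x : Letter) : wordToGroup (FreeMonoid.of x) = FreeGroup.of x :=
  FreeMonoid.lift_eval_of _ _

theorem exists_perm {i j : Letter} (hij : i ≠ j) :
    ∃ π : Equiv.Perm Letter, π .a = j ∧ π .b = i := by
  refine ⟨Equiv.swap .a j * Equiv.swap .b (Equiv.swap .a j i), ?_, by simp⟩
  have h : Equiv.swap .a j i ≠ .a := by
    intro h
    rw [Equiv.swap_apply_eq_iff, Equiv.swap_apply_left] at h
    exact hij h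
  rw [Equiv.Perm.mul_apply, Equiv.swap_apply_of_ne_of_ne (by simp) h.symm, Equiv.swap_apply_left]

theorem ofPerm_mem (π : Equiv.Perm Letter) : ofPerm π ∈ simpleMonoid :=
  Submonoid.subset_closure (Or.inl ⟨π, rfl⟩)

theorem elemL_mem {i j : Letter} (hij : i ≠ j) : elemL i j ∈ simpleMonoid := by
  obtain ⟨π, rfl, rfl⟩ := exists_perm hij
  have : elemL (π .b) (π .a) = ofPerm π * phiL * ofPerm π⁻¹ := by
    refine FreeMonoid.hom_eq fun x => ?_
    obtain ⟨y, rfl⟩ := π.surjective x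
    change elemL (π .b) (π .a) (FreeMonoid.of (π y)) =
      ofPerm π (phiL (ofPerm π⁻¹ (FreeMonoid.of (π y))))
    rw [ofPerm_of, show π⁻¹ (π y) = y from π.symm_apply_apply y]
    cases y <;> simp [elemL_of, ofPerm_of, phiL, ofTriple_of]
  rw [this]
  exact mul_mem (mul_mem (ofPerm_mem _) (Submonoid.subset_closure (by simp))) (ofPerm_mem _)

theorem elemR_mem {i j : Letter} (hij : i ≠ j) : elemR i j ∈ simpleMonoid := by
  obtain ⟨π, rfl, rfl⟩ := exists_perm hij
  have : elemR (π .b) (π .a) = ofPerm π * phiR * ofPerm π⁻¹ := by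
    refine FreeMonoid.hom_eq fun x => ?_
    obtain ⟨y, rfl⟩ := π.surjective x
    change elemR (π .b) (π .a) (FreeMonoid.of (π y)) =
      ofPerm π (phiR (ofPerm π⁻¹ (FreeMonoid.of (π y))))
    rw [ofPerm_of, show π⁻¹ (π y) = y from π.symm_apply_apply y]
    cases y <;> simp [elemR_of, ofPerm_of, phiR, ofTriple_of]
  rw [this]
  exact mul_mem (mul_mem (ofPerm_mem _) (Submonoid.subset_closure (by simp))) (ofPerm_mem _)

theorem elemL_extend_bijective {i j : Letter} (hij : i ≠ j) :
    Function.Bijective (elemL i j).extend := by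
  let g : FreeGroup Letter →* FreeGroup Letter := FreeGroup.lift fun x =>
    if x = j then (FreeGroup.of i)⁻¹ * FreeGroup.of j else FreeGroup.of x
  have h1 : g.comp (elemL i j).extend = MonoidHom.id _ := by
    refine FreeGroup.ext_hom _ _ fun x => ?_
    rw [MonoidHom.comp_apply, extend_of]
    by_cases hx : x = j <;> simp [elemL_of, hx, g, hij]
  have h2 : (elemL i j).extend.comp g = MonoidHom.id _ := by
    refine FreeGroup.ext_hom _ _ fun x => ?_
    rw [MonoidHom.comp_apply]
    by_cases hx : x = j <;> simp [elemL_of, hx, g, hij, extend_of]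
  exact Function.bijective_iff_has_inverse.mpr
    ⟨g, fun x => DFunLike.congr_fun h1 x, fun x => DFunLike.congr_fun h2 x⟩

theorem elemR_extend_bijective {i j : Letter} (hij : i ≠ j) :
    Function.Bijective (elemR i j).extend := by
  let g : FreeGroup Letter →* FreeGroup Letter := FreeGroup.lift fun x =>
    if x = j then FreeGroup.of j * (FreeGroup.of i)⁻¹ else FreeGroup.of x
  have h1 : g.comp (elemR i j).extend = MonoidHom.id _ := by
    refine FreeGroup.ext_hom _ _ fun x => ?_
    rw [MonoidHom.comp_apply, extend_of]
    by_cases hx : x = j <;> simp [elemR_of, hx, g, hij]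
  have h2 : (elemR i j).extend.comp g = MonoidHom.id _ := by
    refine FreeGroup.ext_hom _ _ fun x => ?_
    rw [MonoidHom.comp_apply]
    by_cases hx : x = j <;> simp [elemR_of, hx, g, hij, extend_of]
  exact Function.bijective_iff_has_inverse.mpr
    ⟨g, fun x => DFunLike.congr_fun h1 x, fun x => DFunLike.congr_fun h2 x⟩

/-! ### Factoring and rotating -/

/-- The triple `f` of words becomes a simple substitution after conjugation by a common suffix, or
by the inverse of a common prefix. -/
def IsConjSimple (f : Letter → List Letter) : Prop :=
  ∃ w : FreeGroup Letter, IsSimpleSubstitution ((innerAut w).comp (wordsHom f)) ∧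
    ((∃ u, w = pos u ∧ ∀ x, u <:+ f x) ∨ ∃ u, w⁻¹ = pos u ∧ ∀ x, u <+: f x)

/-- A simple factor on the right does not affect the conjugator, so only the common prefixes and
suffixes have to be carried over. -/
theorem IsConjSimple.of_factor {f g : Letter → List Letter} {τ : Substitution}
    (h : IsConjSimple g) (hτ : τ ∈ simpleMonoid) (hf : wordsHom f = (wordsHom g).comp τ.extend)
    (hs : ∀ u, (∀ x, u <:+ g x) → ∀ x, u <:+ f x)
    (hp : ∀ u, (∀ x, u <+: g x) → ∀ x, u <+: f x) : IsConjSimple f := by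
  obtain ⟨w, ⟨θ, hθ, h1⟩, h2⟩ := h
  refine ⟨w, ⟨θ * τ, mul_mem hθ hτ, ?_⟩, ?_⟩
  · rw [hf, ← MonoidHom.comp_assoc, h1, extend_mul]
  · exact h2.imp (fun ⟨u, hu, h⟩ => ⟨u, hu, hs u h⟩) fun ⟨u, hu, h⟩ => ⟨u, hu, hp u h⟩

theorem innerAut_mul (v w : FreeGroup Letter) :
    innerAut (v * w) = (innerAut v).comp (innerAut w) := by
  refine MonoidHom.ext fun x => ?_
  simp [innerAut]

theorem innerAut_bijective (w : FreeGroup Letter) : Function.Bijective (innerAut w) :=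
  (MulAut.conj w).bijective

theorem wordsHom_rotate_left (c : List Letter) (g : Letter → List Letter) :
    wordsHom (fun x => g x ++ c) = (innerAut (pos c)⁻¹).comp (wordsHom fun x => c ++ g x) := by
  refine FreeGroup.ext_hom _ _ fun x => ?_
  simp [innerAut]

theorem wordsHom_rotate_right (d : List Letter) (g : Letter → List Letter) :
    wordsHom (fun x => d ++ g x) = (innerAut (pos d)).comp (wordsHom fun x => g x ++ d) := by
  refine FreeGroup.ext_hom _ _ fun x => ?_
  simp [innerAut, mul_assoc]

/-- As the rotated words have no common prefix, their conjugator is a common suffix u. Undoing the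
rotation gives u c⁻¹, which does not mix signs because u and c are both suffixes of the same word.
-/
theorem IsConjSimple.of_rotate_left {c : List Letter} {g : Letter → List Letter}
    (h : IsConjSimple fun x => g x ++ c)
    (hc : ∀ u, (∀ x, u <+: g x ++ c) → u = []) : IsConjSimple fun x => c ++ g x := by
  obtain ⟨w, h1, h2⟩ := h
  refine ⟨w * (pos c)⁻¹, ?_, ?_⟩
  · rwa [innerAut_mul, MonoidHom.comp_assoc, ← wordsHom_rotate_left]
  · obtain ⟨u, rfl, hu⟩ : ∃ u, w = pos u ∧ ∀ x, u <:+ g x ++ c := by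
      refine h2.elim id ?_
      rintro ⟨u, hw, hu⟩
      rw [hc u hu, pos_nil, inv_eq_one] at hw
      exact ⟨[], hw, fun x => List.nil_suffix⟩
    rcases List.suffix_or_suffix_of_suffix (hu .a) (List.suffix_append _ c) with
      ⟨c', rfl⟩ | ⟨u', rfl⟩
    · exact Or.inr ⟨c', by simp, fun x => by simp⟩
    · refine Or.inl ⟨u', by simp, fun x => ?_⟩
      obtain ⟨v, hv⟩ := hu x
      have hv' : v ++ u' = g x := by simpa [← List.append_assoc] using hv
      exact ⟨c ++ v, by simp [← hv']⟩

theorem IsConjSimple.of_rotate_right {d : List Letter} {g : Letter → List Letter}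
    (h : IsConjSimple fun x => d ++ g x)
    (hd : ∀ u, (∀ x, u <:+ d ++ g x) → u = []) : IsConjSimple fun x => g x ++ d := by
  obtain ⟨w, h1, h2⟩ := h
  refine ⟨w * pos d, ?_, ?_⟩
  · rwa [innerAut_mul, MonoidHom.comp_assoc, ← wordsHom_rotate_right]
  · obtain ⟨u, hw, hu⟩ : ∃ u, w⁻¹ = pos u ∧ ∀ x, u <+: d ++ g x := by
      refine h2.elim ?_ id
      rintro ⟨u, hw, hu⟩
      rw [hd u hu, pos_nil] at hw
      exact ⟨[], by simp [hw], fun x => List.nil_prefix⟩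
    obtain rfl := inv_eq_iff_eq_inv.mp hw
    rcases List.prefix_or_prefix_of_prefix (hu .a) (List.prefix_append d _) with
      ⟨d', rfl⟩ | ⟨u', rfl⟩
    · exact Or.inl ⟨d', by simp, fun x => ⟨g x ++ u, by simp⟩⟩
    · refine Or.inr ⟨u', by simp, fun x => ?_⟩
      exact ((List.prefix_append_right_inj _).mp (hu x)).trans (List.prefix_append _ _)

theorem ne_nil_of_bijective {f : Letter → List Letter} (hf : Function.Bijective (wordsHom f))
    (x : Letter) : f x ≠ [] := by
  intro h
  have h1 : wordsHom f (FreeGroup.of x) = wordsHom f 1 := by simp [h]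
  exact FreeGroup.of_ne_one x (hf.1 h1)

theorem sum_length_update_lt {f : Letter → List Letter} {j : Letter} {y : List Letter}
    (h : y.length < (f j).length) :
    ∑ x, (Function.update f j y x).length < ∑ x, (f x).length := by
  refine Finset.sum_lt_sum (fun x _ => ?_) ⟨j, Finset.mem_univ j, by simpa using h⟩
  by_cases hx : x = j
  · subst hx; simpa using h.le
  · simp [hx]

/-- Write f(j) = f(i) y and replace f(j) by y. A common suffix of the new triple ends y and hence
f(j); a common prefix begins f(i) and hence f(j). -/
theorem isConjSimple_of_prefix {f : Letter → List Letter} (hf : Function.Bijective (wordsHom f))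
    (ih : ∀ g : Letter → List Letter, ∑ x, (g x).length < ∑ x, (f x).length →
      Function.Bijective (wordsHom g) → IsConjSimple g)
    {i j : Letter} (hij : i ≠ j) (h : f i <+: f j) : IsConjSimple f := by
  obtain ⟨y, hy⟩ := h
  have hfac : wordsHom f = (wordsHom (Function.update f j y)).comp (elemL i j).extend := by
    refine FreeGroup.ext_hom _ _ fun x => ?_
    rw [MonoidHom.comp_apply, extend_of]
    by_cases hx : x = j
    · subst hx
      simp [elemL_of, hij, ← hy]
    · simp [elemL_of, hx]
  refine IsConjSimple.of_factor (ih (Function.update f j y) (sum_length_update_lt ?_) ?_)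
    (elemL_mem hij) hfac ?_ ?_
  · have := List.length_pos_iff.mpr (ne_nil_of_bijective hf i)
    rw [← hy, List.length_append]
    omega
  · rw [hfac, MonoidHom.coe_comp] at hf
    exact (Function.Bijective.of_comp_iff _ (elemL_extend_bijective hij)).mp hf
  · intro u hu x
    by_cases hx : x = j
    · subst hx
      have := hu x
      rw [Function.update_self] at this
      rw [← hy]
      exact this.trans (List.suffix_append _ _)
    · simpa [hx] using hu x
  · intro u hu x
    by_cases hx : x = j
    · subst hx
      have := hu i
      rw [Function.update_of_ne hij] at this
      rw [← hy]
      exact this.trans (List.prefix_append _ _)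
    · simpa [hx] using hu x

theorem isConjSimple_of_suffix {f : Letter → List Letter} (hf : Function.Bijective (wordsHom f))
    (ih : ∀ g : Letter → List Letter, ∑ x, (g x).length < ∑ x, (f x).length →
      Function.Bijective (wordsHom g) → IsConjSimple g)
    {i j : Letter} (hij : i ≠ j) (h : f i <:+ f j) : IsConjSimple f := by
  obtain ⟨y, hy⟩ := h
  have hfac : wordsHom f = (wordsHom (Function.update f j y)).comp (elemR i j).extend := by
    refine FreeGroup.ext_hom _ _ fun x => ?_
    rw [MonoidHom.comp_apply, extend_of]
    by_cases hx : x = j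
    · subst hx
      simp [elemR_of, hij, ← hy]
    · simp [elemR_of, hx]
  refine IsConjSimple.of_factor (ih (Function.update f j y) (sum_length_update_lt ?_) ?_)
    (elemR_mem hij) hfac ?_ ?_
  · have := List.length_pos_iff.mpr (ne_nil_of_bijective hf i)
    rw [← hy, List.length_append]
    omega
  · rw [hfac, MonoidHom.coe_comp] at hf
    exact (Function.Bijective.of_comp_iff _ (elemR_extend_bijective hij)).mp hf
  · intro u hu x
    by_cases hx : x = j
    · subst hx
      have := hu i
      rw [Function.update_of_ne hij] at this
      rw [← hy]
      exact this.trans (List.suffix_append _ _)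
    · simpa [hx] using hu x
  · intro u hu x
    by_cases hx : x = j
    · subst hx
      have := hu x
      rw [Function.update_self] at this
      rw [← hy]
      exact this.trans (List.prefix_append _ _)
    · simpa [hx] using hu x

theorem isConjSimple_of_length_eq_one {f : Letter → List Letter}
    (hf : Function.Bijective (wordsHom f)) (h : ∀ x, (f x).length = 1) : IsConjSimple f := by
  choose p hp using fun x => List.length_eq_one_iff.mp (h x)
  have hinj : Function.Injective p := by
    intro x y hxy
    refine FreeGroup.of_injective (hf.1 ?_)
    simp [hp, hxy]
  let π : Equiv.Perm Letter := Equiv.ofBijective p (Finite.injective_iff_bijective.mp hinj)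
  refine ⟨1, ⟨ofPerm π, ofPerm_mem π, ?_⟩, Or.inl ⟨[], rfl, fun x => List.nil_suffix⟩⟩
  refine FreeGroup.ext_hom _ _ fun x => ?_
  rw [extend_of, ofPerm_of, wordToGroup_of]
  simp [innerAut, hp, π]
  rfl

theorem eq_nil_of_forall_isPrefix {g : Letter → List Letter} {c u : List Letter}
    (h0 : ∀ x, g x ≠ []) (hg : ¬∃ y, ∀ x, (g x).head? = some y) (hu : ∀ x, u <+: g x ++ c) :
    u = [] := by
  by_contra hne
  obtain ⟨y, u, rfl⟩ := List.exists_cons_of_ne_nil hne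
  refine hg ⟨y, fun x => ?_⟩
  obtain ⟨v, hv⟩ := hu x
  rw [← List.head?_append_of_ne_nil _ (h0 x) (l₂ := c), ← hv]
  rfl

theorem eq_nil_of_forall_isSuffix {g : Letter → List Letter} {d u : List Letter}
    (h0 : ∀ x, g x ≠ []) (hg : ¬∃ y, ∀ x, (g x).getLast? = some y) (hu : ∀ x, u <:+ d ++ g x) :
    u = [] := by
  have := eq_nil_of_forall_isPrefix (g := fun x => (g x).reverse) (c := d.reverse)
    (u := u.reverse) (by simpa using h0) (by simpa using hg) fun x => by
      rw [← List.reverse_append, List.reverse_prefix]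
      exact hu x
  simpa using this

theorem isConjSimple_of_bijective (f : Letter → List Letter)
    (hf : Function.Bijective (wordsHom f)) : IsConjSimple f := by
  induction hn : ∑ x, (f x).length using Nat.strong_induction_on generalizing f with
  | _ n ih =>
  subst hn
  have ih' : ∀ g : Letter → List Letter, ∑ x, (g x).length < ∑ x, (f x).length →
      Function.Bijective (wordsHom g) → IsConjSimple g := fun g hlt hg => ih _ hlt g hg rfl
  clear ih
  obtain ⟨c, g, hfg, hhead⟩ := List.exists_common_prefix Letter.a f
  obtain rfl : f = fun x => c ++ g x := funext hfg
  by_cases h0 : ∃ i, g i = []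
  · obtain ⟨i, hi⟩ := h0
    obtain ⟨j, -, -, hj, -⟩ := Letter.exists_two_ne i
    exact isConjSimple_of_prefix hf ih' hj.symm ⟨g j, by simp [hi]⟩
  push Not at h0
  have hf₁ : Function.Bijective (wordsHom fun x => g x ++ c) := by
    rw [wordsHom_rotate_left]
    exact (innerAut_bijective _).comp hf
  have hsum₁ : ∑ x, (g x ++ c).length = ∑ x, (c ++ g x).length := by
    simp only [List.length_append, add_comm]
  by_cases hsuf : ∃ i j, i ≠ j ∧ g i ++ c <:+ g j ++ c
  · obtain ⟨i, j, hij, h⟩ := hsuf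
    -- The first letters of the g(x) are not all equal, so no common prefix exists after the
    -- rotation.
    refine IsConjSimple.of_rotate_left ?_ fun u hu => eq_nil_of_forall_isPrefix h0 hhead hu
    exact isConjSimple_of_suffix hf₁ (by rwa [hsum₁]) hij h
  push Not at hsuf
  obtain ⟨d, r, hgr, hlast⟩ := List.exists_common_suffix Letter.a g
  obtain rfl : g = fun x => r x ++ d := funext hgr
  have hr0 : ∀ x, r x ≠ [] := by
    intro i hi
    obtain ⟨j, -, -, hj, -⟩ := Letter.exists_two_ne i
    exact hsuf i j hj.symm ⟨r j, by simp [hi]⟩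
  have hhead' : ¬∃ y, ∀ x, (r x).head? = some y := by
    rintro ⟨y, hy⟩
    exact hhead ⟨y, fun x => by rw [List.head?_append_of_ne_nil _ (hr0 x), hy]⟩
  by_cases hpre : ∃ i j, i ≠ j ∧ r i <+: r j
  · obtain ⟨i, j, hij, h⟩ := hpre
    have h' : IsConjSimple fun x => d ++ (c ++ r x) := by
      refine isConjSimple_of_prefix (i := i) (j := j) ?_ ?_ hij ?_
      · rw [wordsHom_rotate_right d fun x => c ++ r x]
        rw [MonoidHom.coe_comp]
        simpa only [List.append_assoc] using (innerAut_bijective (pos d)).comp hf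
      · have hsum : ∑ x, (d ++ (c ++ r x)).length = ∑ x, (c ++ (r x ++ d)).length :=
          Finset.sum_congr rfl fun x _ => by
            simp only [List.length_append]
            omega
        rwa [hsum]
      · simpa using h
    have h'' := h'.of_rotate_right fun u hu =>
      eq_nil_of_forall_isSuffix (d := d ++ c) hr0 hlast (by simpa using hu)
    simpa only [List.append_assoc] using h''
  push Not at hpre
  -- A suffix relation between the r(x) would persist after appending d c, so it has been excluded
  -- already.
  have hone := length_eq_one_of_no_prefix_no_suffix r (d ++ c) hr0 hhead' hlast hpre
    (fun i j hij h => hsuf i j hij (by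
      obtain ⟨z, hz⟩ := h
      exact ⟨z, by simp [← hz]⟩))
    (by
      rw [← FreeGroup.lift_surjective_iff_closure_range_eq_top]
      simpa only [List.append_assoc, wordsHom] using hf₁.2)
  refine isConjSimple_of_length_eq_one hf fun x => ?_
  have := hone x
  simp only [List.length_append] at this ⊢
  omega

end Substitution

open Substitution in
theorem theorem2p1 (σ : Substitution) (hσ : σ.IsInvertible) :
    ∃ w : FreeGroup Letter,
      IsSimpleSubstitution ((innerAut w).comp σ.extend) ∧
      ((∃ u : FreeMonoid Letter, w = wordToGroup u ∧ IsCommonSuffix u σ) ∨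
        (∃ u : FreeMonoid Letter, w⁻¹ = wordToGroup u ∧ IsCommonPrefix u σ)) := by
  rw [IsInvertible, extend_eq_wordsHom] at hσ
  obtain ⟨w, h1, h2⟩ := isConjSimple_of_bijective _ hσ
  refine ⟨w, by rwa [extend_eq_wordsHom], h2.imp ?_ ?_⟩
  · rintro ⟨u, hw, hu⟩
    refine ⟨FreeMonoid.ofList u, by rw [hw, wordToGroup_eq_pos]; rfl, fun x => ?_⟩
    obtain ⟨v, hv⟩ := hu x
    exact ⟨FreeMonoid.ofList v, hv.symm⟩
  · rintro ⟨u, hw, hu⟩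
    refine ⟨FreeMonoid.ofList u, by rw [hw, wordToGroup_eq_pos]; rfl, fun x => ?_⟩
    obtain ⟨v, hv⟩ := hu x
    exact ⟨FreeMonoid.ofList v, hv.symm⟩
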